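/- Let $\Bbbk$ be a field. A DG Poisson algebra is a unital associative $\mathbb{Z}$-graded $\Bbbk$-algebra $A$ with a $\Bbbk$-linear map $d:A\to A$ of degree $1$ and a $\Bbbk$-bilinear bracket $\{\cdot,\cdot\}:A\times A\to A$ of degree $0$ such that $d^2=0$ and, for all homogeneous $a,b,c\in A$, $$ab=(-1)^{|a||b|}ba,\qquad \{a,b\}=-(-1)^{|a||b|}\{b,a\},\qquad \{a,\{b,c\}\}=\{\{a,b\},c\}+(-1)^{|a||b|}\{b,\{a,c\}\},$$ $$\{a,bc\}=\{a,b\}c+(-1)^{|a||b|}b\{a,c\},\qquad d(ab)=d(a)b+(-1)^{|a|}a\,d(b),\qquad d\{a,b\}=\{d(a),b\}+(-1)^{|a|}\{a,d(b)\}.$$ A DG ideal of $A$ is a graded two-sided ideal $I$ with $d(I)\subseteq I$; it is a DG Poisson ideal if moreover $\{I,A\}\subseteq I$. A maximal DG ideal is a maximal element of the set of proper DG ideals. A DG Poisson ideal $P$ is called DG symplectic if there is a maximal DG ideal $M$ of $A$ such that $P$ is the largest DG Poisson ideal contained in $M$. A DG Poisson algebra map is a degree-$0$ homomorphism of $\Bbbk$-algebras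 that commutes with the differentials and the brackets. A (left) DG Poisson $A$-module is a $\mathbb{Z}$-graded left $A$-module $X$ with a $\Bbbk$-linear map $\partial:X\to X$ of degree $1$ and a $\Bbbk$-bilinear map $\{\cdot,\cdot\}_X:A\times X\to X$ of degree $0$ such that $\partial^2=0$ and, for all homogeneous $a,b\in A$ and $m\in X$, $$\partial(am)=d(a)m+(-1)^{|a|}a\,\partial(m),\qquad \partial\{a,m\}_X=\{d(a),m\}_X+(-1)^{|a|}\{a,\partial(m)\}_X,$$ $$\{a,bm\}_X=\{a,b\}m+(-1)^{|a||b|}b\{a,m\}_X,\qquad \{ab,m\}_X=a\{b,m\}_X+(-1)^{|a||b|}b\{a,m\}_X,$$ $$\{a,\{b,m\}_X\}_X=\{\{a,b\},m\}_X+(-1)^{|a||b|}\{b,\{a,m\}_X\}_X.$$ It is simple if $X\neq 0$ and the only graded $A$-submodules $N\subseteq X$ with $\partial(N)\subseteq N$ and $\{A,N\}_X\subseteq N$ are $0$ and $X$. Its annihilator is $\{a\in A: aX=0\}$. Let $V$ be a graded $\Bbbk$-vector space with a homogeneous basis $(x_\alpha)_{\alpha\in\Lambda}$, let $$R=T(V)/\langle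 x_\alpha\otimes x_\beta-(-1)^{|x_\alpha||x_\beta|}x_\beta\otimes x_\alpha : \alpha,\beta\in\Lambda\rangle$$ with the induced grading, and let $R$ carry an arbitrary differential and bracket that make it a DG Poisson algebra. Let $A$ be a DG Poisson homomorphic image of $R$, that is, a DG Poisson algebra with a surjective DG Poisson algebra map $R\to A$ (equivalently, $A\cong R/I$ for a DG Poisson ideal $I$ of $R$). Then every DG symplectic ideal $P$ of $A$ is the annihilator of a simple DG Poisson $A$-module. -/

import Mathlib

universe u v w

open DirectSum

/-! ### The graded-commutative polynomial algebra -/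

/-- The defining relations `x_α x_β = (-1)^(|x_α||x_β|) x_β x_α` on the free algebra
(the tensor algebra of the vector space with basis `Λ`). -/
inductive GradedPoly.Rel (k : Type*) [Field k] {Λ : Type*} (deg : Λ → ℤ) :
    FreeAlgebra k Λ → FreeAlgebra k Λ → Prop
  | comm (α β : Λ) : GradedPoly.Rel k deg (FreeAlgebra.ι k α * FreeAlgebra.ι k β)
      ((deg α * deg β).negOnePow • (FreeAlgebra.ι k β * FreeAlgebra.ι k α))

/-- The graded-commutative polynomial algebra over `k` on generators `x_α` (`α : Λ`) of
degrees `deg α`: the tensor algebra modulo `x_α x_β - (-1)^(|x_α||x_β|) x_β x_α`. -/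
def GradedPoly (k : Type*) [Field k] {Λ : Type*} (deg : Λ → ℤ) : Type _ :=
  RingQuot (GradedPoly.Rel k deg)

namespace GradedPoly

section

variable (k : Type*) [Field k] {Λ : Type*} (deg : Λ → ℤ)

noncomputable instance : Ring (GradedPoly k deg) :=
  inferInstanceAs (Ring (RingQuot (GradedPoly.Rel k deg)))

noncomputable instance : Algebra k (GradedPoly k deg) :=
  inferInstanceAs (Algebra k (RingQuot (GradedPoly.Rel k deg)))

/-- The canonical projection from the free algebra. -/
noncomputable def mk : FreeAlgebra k Λ →ₐ[k] GradedPoly k deg :=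
  RingQuot.mkAlgHom k (GradedPoly.Rel k deg)

/-- The generator `x_α`. -/
noncomputable def X (α : Λ) : GradedPoly k deg :=
  mk k deg (FreeAlgebra.ι k α)

/-- The homogeneous component of degree `n`: the span of the monomials
`x_{α₁} ⋯ x_{α_r}` with `|x_{α₁}| + ⋯ + |x_{α_r}| = n`. -/
noncomputable def grading (n : ℤ) : Submodule k (GradedPoly k deg) :=
  Submodule.span k {x | ∃ l : List Λ, (l.map deg).sum = n ∧ (l.map (X k deg)).prod = x}

variable {k deg}

theorem X_mem (α : Λ) : X k deg α ∈ grading k deg (deg α) :=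
  Submodule.subset_span ⟨[α], by simp, by simp⟩

instance : SetLike.GradedMonoid (grading k deg) where
  one_mem := Submodule.subset_span ⟨[], by simp, by simp⟩
  mul_mem i j x y hx hy := by
    have h : grading k deg i * grading k deg j ≤ grading k deg (i + j) := by
      unfold grading
      rw [Submodule.span_mul_span]
      refine Submodule.span_mono ?_
      rintro _ ⟨_, ⟨l, hl, rfl⟩, _, ⟨l', hl', rfl⟩, rfl⟩
      exact ⟨l ++ l', by simp [hl, hl'], by simp⟩
    exact h (Submodule.mul_mem_mul hx hy)

theorem X_mul_X (α β : Λ) :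
    X k deg α * X k deg β = (deg α * deg β).negOnePow • (X k deg β * X k deg α) := by
  have h := RingQuot.mkAlgHom_rel k (GradedPoly.Rel.comm (k := k) (deg := deg) α β)
  have h' : mk k deg (FreeAlgebra.ι k α * FreeAlgebra.ι k β) =
      mk k deg ((deg α * deg β).negOnePow • (FreeAlgebra.ι k β * FreeAlgebra.ι k α)) := h
  rw [map_mul, Units.smul_def, map_zsmul, map_mul, ← Units.smul_def] at h'
  exact h'

variable (k deg) in
/-- The decomposition into homogeneous components, as an algebra map. -/
noncomputable def decomp : GradedPoly k deg →ₐ[k] ⨁ i, grading k deg i :=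
  RingQuot.liftAlgHom k (s := GradedPoly.Rel k deg) ⟨FreeAlgebra.lift k fun α =>
    DirectSum.of (fun i => grading k deg i) (deg α) ⟨X k deg α, X_mem α⟩, by
      rintro _ _ ⟨α, β⟩
      rw [Units.smul_def, map_zsmul, map_mul, map_mul, FreeAlgebra.lift_ι_apply,
        FreeAlgebra.lift_ι_apply, DirectSum.of_mul_of, DirectSum.of_mul_of, ← map_zsmul]
      refine DirectSum.of_eq_of_gradedMonoid_eq (Sigma.subtype_ext (add_comm _ _) ?_)
      exact (X_mul_X α β).trans (Units.smul_def _ _)⟩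

theorem decomp_X (α : Λ) : decomp k deg (X k deg α) =
    DirectSum.of (fun i => grading k deg i) (deg α) ⟨X k deg α, X_mem α⟩ := by
  have h : decomp k deg (mk k deg (FreeAlgebra.ι k α)) = _ :=
    RingQuot.liftAlgHom_mkAlgHom_apply k _ _ _
  rw [FreeAlgebra.lift_ι_apply] at h
  exact h

theorem mk_surjective : Function.Surjective (mk k deg) :=
  RingQuot.mkAlgHom_surjective k _

theorem prod_mem (l : List Λ) :
    (l.map (X k deg)).prod ∈ grading k deg (l.map deg).sum :=
  Submodule.subset_span ⟨l, rfl, rfl⟩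

theorem decomp_prod (l : List Λ) : decomp k deg (l.map (X k deg)).prod =
    DirectSum.of (fun i => grading k deg i) (l.map deg).sum ⟨_, prod_mem l⟩ := by
  induction l with
  | nil => exact (map_one (decomp k deg)).trans (DirectSum.one_def (fun i => grading k deg i))
  | cons α l ih =>
    have h : decomp k deg ((α :: l).map (X k deg)).prod =
        decomp k deg (X k deg α) * decomp k deg (l.map (X k deg)).prod := by
      rw [List.map_cons, List.prod_cons, map_mul]
    rw [h, ih, decomp_X, DirectSum.of_mul_of]
    exact DirectSum.of_eq_of_gradedMonoid_eq (Sigma.subtype_ext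
      (List.sum_cons (a := deg α) (l := l.map deg)).symm
      (List.prod_cons (a := X k deg α) (l := l.map (X k deg))).symm)

noncomputable instance : GradedAlgebra (grading k deg) :=
  GradedAlgebra.ofAlgHom _ (decomp k deg)
    (by
      have h : ((DirectSum.coeAlgHom (grading k deg)).comp (decomp k deg)).comp (mk k deg) =
          (AlgHom.id k (GradedPoly k deg)).comp (mk k deg) := by
        refine FreeAlgebra.hom_ext ?_
        funext α
        change DirectSum.coeAlgHom (grading k deg) (decomp k deg (X k deg α)) = X k deg α
        rw [decomp_X, DirectSum.coeAlgHom_of]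
      ext x
      obtain ⟨y, rfl⟩ := mk_surjective x
      exact DFunLike.congr_fun h y)
    (by
      rintro i ⟨x, hx⟩
      dsimp only
      unfold grading at hx
      induction hx using Submodule.span_induction with
      | mem x h =>
        obtain ⟨l, rfl, rfl⟩ := h
        exact decomp_prod l
      | zero => rw [map_zero]; exact (map_zero _).symm
      | add x y hx hy ihx ihy =>
        rw [map_add, ihx, ihy, ← map_add]; rfl
      | smul c x hx ih =>
        rw [map_smul, ih, ← DirectSum.lof_eq_of k, ← map_smul]; rfl)

end

end GradedPoly

/-! ### DG Poisson algebras, DG ideals, DG Poisson ideals -/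

/-- A DG Poisson algebra structure on the `ℤ`-graded algebra `A = ⨁ 𝒜 i`: a differential of
degree `1` and a bracket of degree `0`.  The product is graded commutative. -/
structure DGPoisson {k A : Type*} [Field k] [Ring A] [Algebra k A]
    (𝒜 : ℤ → Submodule k A) [GradedAlgebra 𝒜] where
  /-- the differential -/
  d : A →ₗ[k] A
  /-- the Poisson bracket -/
  br : A →ₗ[k] A →ₗ[k] A
  d_mem : ∀ {i : ℤ} {a : A}, a ∈ 𝒜 i → d a ∈ 𝒜 (i + 1)
  br_mem : ∀ {i j : ℤ} {a b : A}, a ∈ 𝒜 i → b ∈ 𝒜 j → br a b ∈ 𝒜 (i + j)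
  antisymm : ∀ {i j : ℤ} {a b : A}, a ∈ 𝒜 i → b ∈ 𝒜 j →
    br a b = -((i * j).negOnePow • br b a)
  jacobi : ∀ {i j l : ℤ} {a b c : A}, a ∈ 𝒜 i → b ∈ 𝒜 j → c ∈ 𝒜 l →
    br a (br b c) = br (br a b) c + (i * j).negOnePow • br b (br a c)
  comm : ∀ {i j : ℤ} {a b : A}, a ∈ 𝒜 i → b ∈ 𝒜 j →
    a * b = (i * j).negOnePow • (b * a)
  br_mul : ∀ {i j l : ℤ} {a b c : A}, a ∈ 𝒜 i → b ∈ 𝒜 j → c ∈ 𝒜 l →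
    br a (b * c) = br a b * c + (i * j).negOnePow • (b * br a c)
  d_d : ∀ a : A, d (d a) = 0
  d_br : ∀ {i j : ℤ} {a b : A}, a ∈ 𝒜 i → b ∈ 𝒜 j →
    d (br a b) = br (d a) b + i.negOnePow • br a (d b)
  d_mul : ∀ {i j : ℤ} {a b : A}, a ∈ 𝒜 i → b ∈ 𝒜 j →
    d (a * b) = d a * b + i.negOnePow • (a * d b)

namespace DGPoisson

section

variable {k A B : Type*} [Field k] [Ring A] [Algebra k A] [Ring B] [Algebra k B]
  {𝒜 : ℤ → Submodule k A} [GradedAlgebra 𝒜] {ℬ : ℤ → Submodule k B} [GradedAlgebra ℬ]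

/-- A DG ideal: a graded two-sided ideal stable under the differential. -/
structure IsDGIdeal (S : DGPoisson 𝒜) (I : Ideal A) : Prop where
  isTwoSided : I.IsTwoSided
  isHomogeneous : I.IsHomogeneous 𝒜
  d_mem : ∀ a ∈ I, S.d a ∈ I

/-- A DG Poisson ideal: a DG ideal `I` with `{I, A} ⊆ I`. -/
structure IsDGPoissonIdeal (S : DGPoisson 𝒜) (I : Ideal A) : Prop
    extends S.IsDGIdeal I where
  br_mem : ∀ a ∈ I, ∀ b : A, S.br a b ∈ I

/-- A maximal DG ideal: maximal among the proper DG ideals. -/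
def IsMaximalDGIdeal (S : DGPoisson 𝒜) (M : Ideal A) : Prop :=
  Maximal (fun J : Ideal A => S.IsDGIdeal J ∧ J ≠ ⊤) M

/-- A DG symplectic ideal: the largest DG Poisson ideal contained in some maximal DG ideal. -/
def IsSymplectic (S : DGPoisson 𝒜) (P : Ideal A) : Prop :=
  ∃ M : Ideal A, S.IsMaximalDGIdeal M ∧
    IsGreatest {Q : Ideal A | S.IsDGPoissonIdeal Q ∧ Q ≤ M} P

/-- A DG Poisson algebra map: an algebra map of degree `0` commuting with the differentials and
the brackets. -/
structure IsHom (S : DGPoisson 𝒜) (T : DGPoisson ℬ) (f : A →ₐ[k] B) : Prop where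
  map_mem : ∀ {i : ℤ} {a : A}, a ∈ 𝒜 i → f a ∈ ℬ i
  map_d : ∀ a : A, f (S.d a) = T.d (f a)
  map_br : ∀ a b : A, f (S.br a b) = T.br (f a) (f b)

end

end DGPoisson

/-! ### DG Poisson modules -/

/-- A left DG Poisson module structure over the DG Poisson algebra `(A, S)` on the graded left
`A`-module `X = ⨁ ℳ i`. -/
structure DGPoissonModule {k A X : Type*} [Field k] [Ring A] [Algebra k A]
    {𝒜 : ℤ → Submodule k A} [GradedAlgebra 𝒜] (S : DGPoisson 𝒜)
    [AddCommGroup X] [Module k X] [Module A X] [IsScalarTower k A X]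
    (ℳ : ℤ → Submodule k X) [DirectSum.Decomposition ℳ] [SetLike.GradedSMul 𝒜 ℳ] where
  /-- the differential -/
  d : X →ₗ[k] X
  /-- the bracket `{a, m}` -/
  br : A →ₗ[k] X →ₗ[k] X
  d_mem : ∀ {i : ℤ} {m : X}, m ∈ ℳ i → d m ∈ ℳ (i + 1)
  br_mem : ∀ {i j : ℤ} {a : A} {m : X}, a ∈ 𝒜 i → m ∈ ℳ j → br a m ∈ ℳ (i + j)
  d_d : ∀ m : X, d (d m) = 0
  d_smul : ∀ {i j : ℤ} {a : A} {m : X}, a ∈ 𝒜 i → m ∈ ℳ j →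
    d (a • m) = S.d a • m + i.negOnePow • (a • d m)
  br_smul : ∀ {i j l : ℤ} {a b : A} {m : X}, a ∈ 𝒜 i → b ∈ 𝒜 j → m ∈ ℳ l →
    br a (b • m) = S.br a b • m + (i * j).negOnePow • (b • br a m)
  mul_br : ∀ {i j l : ℤ} {a b : A} {m : X}, a ∈ 𝒜 i → b ∈ 𝒜 j → m ∈ ℳ l →
    br (a * b) m = a • br b m + (i * j).negOnePow • (b • br a m)
  br_br : ∀ {i j l : ℤ} {a b : A} {m : X}, a ∈ 𝒜 i → b ∈ 𝒜 j → m ∈ ℳ l →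
    br a (br b m) = br (S.br a b) m + (i * j).negOnePow • br b (br a m)
  d_br : ∀ {i j : ℤ} {a : A} {m : X}, a ∈ 𝒜 i → m ∈ ℳ j →
    d (br a m) = br (S.d a) m + i.negOnePow • br a (d m)

namespace DGPoissonModule

section

variable {k A X : Type*} [Field k] [Ring A] [Algebra k A]
  {𝒜 : ℤ → Submodule k A} [GradedAlgebra 𝒜] {S : DGPoisson 𝒜}
  [AddCommGroup X] [Module k X] [Module A X] [IsScalarTower k A X]
  {ℳ : ℤ → Submodule k X} [DirectSum.Decomposition ℳ] [SetLike.GradedSMul 𝒜 ℳ]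

/-- A DG Poisson submodule: a graded submodule stable under the differential and under the
brackets with elements of `A`. -/
structure IsDGPoissonSubmodule (D : DGPoissonModule S ℳ) (N : Submodule A X) : Prop where
  isHomogeneous : N.IsHomogeneous ℳ
  d_mem : ∀ m ∈ N, D.d m ∈ N
  br_mem : ∀ a : A, ∀ m ∈ N, D.br a m ∈ N

/-- A simple DG Poisson module: nonzero, and without nonzero proper DG Poisson submodules. -/
structure IsSimple (D : DGPoissonModule S ℳ) : Prop where
  nontrivial : Nontrivial X
  eq_bot_or_eq_top : ∀ N : Submodule A X, D.IsDGPoissonSubmodule N → N = ⊥ ∨ N = ⊤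

end

end DGPoissonModule

/-!
The algebra `A` acts on functionals on `A` by `(b • φ) a = φ (a * b)`, `{b, φ} a = φ {a, b}` and
`(dφ) a = -(-1) ^ |a| * φ (d a)`, and the sums of homogeneous functionals form a DG Poisson module.
Let `P` be the largest DG Poisson ideal inside the maximal DG ideal `M`, take a nonzero functional
`φ` of degree `0` killed by `M`, and let `W` be the DG Poisson submodule it generates. By Zorn's
lemma there is a DG Poisson submodule `L` of `W` maximal among those avoiding `φ`; as `φ` generates
`W`, the quotient `X = W / L` is simple. The elements of `X` killed by `P` form a DG Poisson
submodule containing the nonzero class of `φ`, so `P` kills `X`. Conversely `Ann X` is a DG Poisson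
ideal, and `M + Ann X` is a DG ideal killing the class of `φ`, hence proper, so `Ann X ≤ M` by
maximality and `Ann X ≤ P`.
-/

section GradedModule

variable {ι k A X Y : Type*} [CommRing k] [AddCommGroup X] [Module k X] [AddCommGroup Y]

section Decomposition

variable [DecidableEq ι]

theorem map_mem_of_isHomogeneous {F P Q : Type*} [FunLike F X Y] [AddMonoidHomClass F X Y]
    [SetLike P X] [SetLike Q Y] [AddSubmonoidClass Q Y] (ℳ : ι → Submodule k X)
    [Decomposition ℳ] {p : P} {q : Q} (hp : SetLike.IsHomogeneous ℳ p) (f : F)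
    (hf : ∀ i, ∀ x ∈ ℳ i, x ∈ p → f x ∈ q) {x : X} (hx : x ∈ p) : f x ∈ q := by
  classical
  rw [← sum_support_decompose ℳ x, map_sum]
  exact sum_mem fun i _ => hf i _ (decompose ℳ x i).2 (hp i hx)

theorem map_mem_of_forall_homogeneous {F Q : Type*} [FunLike F X Y] [AddMonoidHomClass F X Y]
    [SetLike Q Y] [AddSubmonoidClass Q Y] (ℳ : ι → Submodule k X) [Decomposition ℳ] {q : Q}
    (f : F) (hf : ∀ i, ∀ x ∈ ℳ i, f x ∈ q) (x : X) : f x ∈ q :=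
  map_mem_of_isHomogeneous ℳ (p := (⊤ : Submodule k X)) (fun _ _ _ => Submodule.mem_top) f
    (fun i x hx _ => hf i x hx) Submodule.mem_top

theorem linearMap_ext_of_homogeneous [Module k Y] (ℳ : ι → Submodule k X) [Decomposition ℳ]
    {f g : X →ₗ[k] Y} (h : ∀ i, ∀ x ∈ ℳ i, f x = g x) : f = g :=
  decompose_lhom_ext ℳ fun i => LinearMap.ext fun x => h i x x.2

theorem coe_decompose_apply_of_injective {κ F : Type*} [DecidableEq κ] [Module k Y]
    [FunLike F X Y] [AddMonoidHomClass F X Y] (ℳ : ι → Submodule k X) [Decomposition ℳ]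
    (𝒩 : κ → Submodule k Y) [Decomposition 𝒩] {e : ι → κ} (he : Function.Injective e) (f : F)
    (hf : ∀ i, ∀ x ∈ ℳ i, f x ∈ 𝒩 (e i)) (x : X) (i : ι) :
    (decompose 𝒩 (f x) (e i) : Y) = f (decompose ℳ x i) := by
  induction x using Decomposition.inductionOn ℳ with
  | zero => simp
  | @homogeneous j m =>
    obtain rfl | h := eq_or_ne j i
    · rw [decompose_of_mem_same _ (hf _ _ m.2), decompose_of_mem_same _ m.2]
    · rw [decompose_of_mem_ne _ (hf _ _ m.2) (he.ne h), decompose_of_mem_ne _ m.2 h, map_zero]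
  | add x y hx hy => simp [decompose_add, hx, hy]

/-- The projection of a graded module onto its homogeneous component of degree `i`, as an
endomorphism; the counterpart for modules of `GradedAlgebra.proj`. -/
noncomputable def componentMap (ℳ : ι → Submodule k X) [Decomposition ℳ] (i : ι) : X →ₗ[k] X :=
  (ℳ i).subtype ∘ₗ DirectSum.component k ι (fun i => ℳ i) i ∘ₗ
    (decomposeLinearEquiv ℳ).toLinearMap

theorem componentMap_of_mem_same {ℳ : ι → Submodule k X} [Decomposition ℳ] {i : ι} {x : X}
    (hx : x ∈ ℳ i) : componentMap ℳ i x = x :=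
  decompose_of_mem_same ℳ hx

theorem componentMap_of_mem_ne {ℳ : ι → Submodule k X} [Decomposition ℳ] {i j : ι} {x : X}
    (hx : x ∈ ℳ j) (hji : j ≠ i) : componentMap ℳ i x = 0 :=
  decompose_of_mem_ne ℳ hx hji

end Decomposition

variable [Ring A] [Algebra k A] [Module A X] [IsScalarTower k A X]

section Submodule

variable (ℳ : ι → Submodule k X) (W : Submodule A X)

/-- The grading of a submodule `W` by the intersections of `W` with the pieces `ℳ i`. -/
def submoduleGrading (i : ι) : Submodule k W := (ℳ i).comap (W.subtype.restrictScalars k)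

instance [Add ι] (𝒜 : ι → Submodule k A) [SetLike.GradedSMul 𝒜 ℳ] :
    SetLike.GradedSMul 𝒜 (submoduleGrading ℳ W) where
  smul_mem _ _ _ m ha hm := SetLike.GradedSMul.smul_mem (A := 𝒜) (B := ℳ) (bj := (m : X)) ha hm

variable {ℳ W}

/-- A submodule spanned by its intersections with independent pieces `ℳ i` is graded; the `ℳ i`
need not exhaust the ambient module. -/
@[reducible]
noncomputable def submoduleDecomposition [DecidableEq ι] (hℳ : iSupIndep ℳ)
    (hW : W.restrictScalars k ≤ ⨆ i, W.restrictScalars k ⊓ ℳ i) :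
    Decomposition (submoduleGrading ℳ W) :=
  IsInternal.chooseDecomposition _ <| by
    let f : W →ₗ[k] X := W.subtype.restrictScalars k
    have hrange : LinearMap.range f = W.restrictScalars k :=
      SetLike.coe_injective Subtype.range_coe
    rw [isInternal_submodule_iff_iSupIndep_and_iSup_eq_top]
    constructor
    · refine fun i => Submodule.disjoint_def.2 fun x hx hx' => Subtype.ext ?_
      have hle : (⨆ j, ⨆ _ : j ≠ i, submoduleGrading ℳ W j).map f ≤ ⨆ j, ⨆ _ : j ≠ i, ℳ j := by
        simp only [Submodule.map_iSup]
        exact iSup₂_mono fun j _ => Submodule.map_comap_le f (ℳ j)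
      exact Submodule.disjoint_def.1 (hℳ i) x hx (hle ⟨x, hx', rfl⟩)
    · refine Submodule.map_injective_of_injective (f := f) W.injective_subtype ?_
      rw [Submodule.map_iSup, Submodule.map_top, hrange]
      refine le_antisymm (iSup_le fun i => ?_) (hW.trans (iSup_mono fun i => ?_))
      · rw [← hrange]
        exact LinearMap.map_le_range
      · rw [submoduleGrading, Submodule.map_comap_eq, hrange]

theorem restrictScalars_le_iSup_inf [DecidableEq ι] [Decomposition ℳ]
    (hW : W.IsHomogeneous ℳ) :
    W.restrictScalars k ≤ ⨆ i, W.restrictScalars k ⊓ ℳ i := fun _ =>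
  map_mem_of_isHomogeneous ℳ hW (LinearMap.id : X →ₗ[k] X) fun i _ hxi hx =>
    Submodule.mem_iSup_of_mem (p := fun i => W.restrictScalars k ⊓ ℳ i) i ⟨hx, hxi⟩

/-- The decomposition of a homogeneous submodule of a graded module. -/
@[reducible]
noncomputable def homogeneousDecomposition [DecidableEq ι] [Decomposition ℳ]
    (hW : W.IsHomogeneous ℳ) : Decomposition (submoduleGrading ℳ W) :=
  submoduleDecomposition (Decomposition.isInternal ℳ).submodule_iSupIndep
    (restrictScalars_le_iSup_inf hW)

end Submodule

section Quotient

/-- The endomorphism of `X ⧸ L` induced by a `k`-linear endomorphism of `X` preserving the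
`A`-submodule `L`. -/
def quotientMap {L : Submodule A X} (f : X →ₗ[k] X) (hf : ∀ x ∈ L, f x ∈ L) :
    X ⧸ L →ₗ[k] X ⧸ L :=
  (Submodule.Quotient.restrictScalarsEquiv k L).conj ((L.restrictScalars k).mapQ _ f hf)

/-- The bilinear version of `quotientMap`. -/
def quotientMap₂ {Z : Type*} [AddCommGroup Z] [Module k Z] {L : Submodule A X}
    (f : Z →ₗ[k] X →ₗ[k] X) (hf : ∀ z, ∀ x ∈ L, f z x ∈ L) : Z →ₗ[k] X ⧸ L →ₗ[k] X ⧸ L :=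
  (Submodule.Quotient.restrictScalarsEquiv k L).conj.toLinearMap ∘ₗ
    Submodule.mapQLinear (L.restrictScalars k) (L.restrictScalars k) ∘ₗ
    f.codRestrict ((L.restrictScalars k).compatibleMaps (L.restrictScalars k)) hf

variable (ℳ : ι → Submodule k X) (L : Submodule A X)

/-- The grading of a quotient by the images of the homogeneous components. -/
def quotientGrading (i : ι) : Submodule k (X ⧸ L) := (ℳ i).map (L.mkQ.restrictScalars k)

instance [Add ι] (𝒜 : ι → Submodule k A) [SetLike.GradedSMul 𝒜 ℳ] :
    SetLike.GradedSMul 𝒜 (quotientGrading ℳ L) where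
  smul_mem := by
    rintro i j a _ ha ⟨x, hx, rfl⟩
    exact ⟨a • x, SetLike.GradedSMul.smul_mem ha hx, rfl⟩

variable {ℳ L}

theorem mkQ_mem_quotientGrading {i : ι} {x : X} (hx : x ∈ ℳ i) :
    L.mkQ x ∈ quotientGrading ℳ L i :=
  ⟨x, hx, rfl⟩

/-- The decomposition of the quotient of a graded module by a homogeneous submodule. -/
@[reducible]
noncomputable def quotientDecomposition [DecidableEq ι] [Decomposition ℳ]
    (hL : L.IsHomogeneous ℳ) : Decomposition (quotientGrading ℳ L) :=
  IsInternal.chooseDecomposition _ <| by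
    let p (i : ι) : X ⧸ L →ₗ[k] X ⧸ L := quotientMap (componentMap ℳ i) fun _ hx => hL i hx
    rw [isInternal_submodule_iff_iSupIndep_and_iSup_eq_top]
    constructor
    · refine fun i => Submodule.disjoint_def.2 ?_
      rintro _ ⟨x, hx, rfl⟩ hx'
      have hle : ⨆ j, ⨆ _ : j ≠ i, quotientGrading ℳ L j ≤ LinearMap.ker (p i) := by
        refine iSup₂_le fun j hji => ?_
        rintro _ ⟨y, hy, rfl⟩
        exact (congrArg L.mkQ (componentMap_of_mem_ne hy hji)).trans L.mkQ.map_zero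
      exact (congrArg L.mkQ (componentMap_of_mem_same hx)).symm.trans (hle hx')
    · refine eq_top_iff.2 fun x _ => ?_
      obtain ⟨x, rfl⟩ := L.mkQ_surjective x
      exact map_mem_of_forall_homogeneous ℳ L.mkQ (fun i x hx =>
        Submodule.mem_iSup_of_mem (p := quotientGrading ℳ L) i (mkQ_mem_quotientGrading hx)) x

end Quotient

section Annihilator

variable {𝒜 : ι → Submodule k A}

/-- The submodule of the elements of `X` annihilated by a two-sided ideal `I`; the noncommutative
counterpart of `Submodule.torsionBySet`. -/
def annihilatedBy {A : Type*} [Ring A] (X : Type*) [AddCommGroup X] [Module A X] (I : Ideal A)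
    [I.IsTwoSided] : Submodule A X where
  carrier := {x | ∀ a ∈ I, a • x = 0}
  zero_mem' a _ := smul_zero a
  add_mem' hx hy a ha := by rw [smul_add, hx a ha, hy a ha, add_zero]
  smul_mem' b x hx a ha := by
    rw [← mul_smul]
    exact hx _ (I.mul_mem_right b ha)

theorem mem_annihilatedBy_of_homogeneous {X : Type*} [AddCommGroup X] [Module A X]
    [DecidableEq ι] [Decomposition 𝒜] {I : Ideal A} [I.IsTwoSided]
    (hI : SetLike.IsHomogeneous 𝒜 I) {x : X} (h : ∀ i, ∀ a ∈ 𝒜 i, a ∈ I → a • x = 0) :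
    x ∈ annihilatedBy X I := fun _ =>
  map_mem_of_isHomogeneous 𝒜 hI (q := (⊥ : Submodule A X)) (LinearMap.toSpanSingleton A X x) h

variable [DecidableEq ι] [Add ι] [Decomposition 𝒜]

theorem isHomogeneous_annihilatedBy [IsLeftCancelAdd ι] (ℳ : ι → Submodule k X)
    [Decomposition ℳ] [SetLike.GradedSMul 𝒜 ℳ] {I : Ideal A} [I.IsTwoSided]
    (hI : SetLike.IsHomogeneous 𝒜 I) : (annihilatedBy X I).IsHomogeneous ℳ := fun j x hx =>
  mem_annihilatedBy_of_homogeneous hI fun i a hai ha => by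
    have hsmul : (decompose ℳ (a • x) (i + j) : X) = a • (decompose ℳ x j : X) :=
      coe_decompose_apply_of_injective ℳ ℳ (add_right_injective i) (Algebra.lsmul k k X a)
        (fun _ _ hm => SetLike.GradedSMul.smul_mem hai hm) x j
    simp [← hsmul, hx a ha]

variable (𝒜) in
theorem isHomogeneous_annihilator [IsRightCancelAdd ι] (ℳ : ι → Submodule k X)
    [Decomposition ℳ] [SetLike.GradedSMul 𝒜 ℳ] :
    SetLike.IsHomogeneous 𝒜 (Module.annihilator A X) := fun i a ha => by
  rw [Module.mem_annihilator] at ha ⊢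
  refine LinearMap.congr_fun (linearMap_ext_of_homogeneous ℳ
    (f := Algebra.lsmul k k X (decompose 𝒜 a i : A)) (g := 0) fun j m hm => ?_)
  have hsmul : (decompose ℳ (a • m) (i + j) : X) = (decompose 𝒜 a i : A) • m :=
    coe_decompose_apply_of_injective 𝒜 ℳ (add_left_injective j) (LinearMap.toSpanSingleton A X m)
      (fun _ _ hb => SetLike.GradedSMul.smul_mem hb hm) a i
  simp [← hsmul, ha]

end Annihilator

end GradedModule

section Annihilator

variable {k A X : Type*} [Field k] [Ring A] [Algebra k A]
  {𝒜 : ℤ → Submodule k A} [GradedAlgebra 𝒜] {S : DGPoisson 𝒜}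
  [AddCommGroup X] [Module k X] [Module A X] [IsScalarTower k A X]
  {ℳ : ℤ → Submodule k X} [DirectSum.Decomposition ℳ] [SetLike.GradedSMul 𝒜 ℳ]

namespace DGPoisson

variable {I J : Ideal A}

theorem isTwoSided_of_isHomogeneous (S : DGPoisson 𝒜) (hI : I.IsHomogeneous 𝒜) :
    I.IsTwoSided :=
  ⟨fun b => map_mem_of_isHomogeneous 𝒜 hI (LinearMap.mulRight k b) fun _ a hai ha =>
    map_mem_of_forall_homogeneous 𝒜 (LinearMap.mulLeft k a) (fun _ c hc => by
      rw [LinearMap.mulLeft_apply, S.comm hai hc, Units.smul_def]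
      exact zsmul_mem (I.mul_mem_left c ha) _) b⟩

theorem br_mem_comm (S : DGPoisson 𝒜) {i j : ℤ} {a b : A} (ha : a ∈ 𝒜 i) (hb : b ∈ 𝒜 j) :
    S.br a b ∈ I ↔ S.br b a ∈ I := by
  rw [S.antisymm ha hb, neg_mem_iff]
  rcases Int.units_eq_one_or (i * j).negOnePow with h | h <;> simp [h]

theorem IsDGIdeal.sup (hI : S.IsDGIdeal I) (hJ : S.IsDGIdeal J) : S.IsDGIdeal (I ⊔ J) where
  isTwoSided := S.isTwoSided_of_isHomogeneous (hI.isHomogeneous.sup hJ.isHomogeneous)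
  isHomogeneous := hI.isHomogeneous.sup hJ.isHomogeneous
  d_mem a ha := by
    obtain ⟨b, hb, c, hc, rfl⟩ := Submodule.mem_sup.1 ha
    rw [map_add]
    exact Submodule.add_mem_sup (hI.d_mem b hb) (hJ.d_mem c hc)

end DGPoisson

namespace DGPoissonModule

theorem d_smul_of_mem (D : DGPoissonModule S ℳ) {i : ℤ} {a : A} (ha : a ∈ 𝒜 i) (m : X) :
    D.d (a • m) = S.d a • m + i.negOnePow • (a • D.d m) := by
  induction m using Decomposition.inductionOn ℳ with
  | zero => simp
  | homogeneous m => exact D.d_smul ha m.2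
  | add x y hx hy => simp only [smul_add, map_add, hx, hy]; abel

theorem br_smul_of_mem (D : DGPoissonModule S ℳ) {i j : ℤ} {a b : A} (ha : a ∈ 𝒜 i)
    (hb : b ∈ 𝒜 j) (m : X) :
    D.br a (b • m) = S.br a b • m + (i * j).negOnePow • (b • D.br a m) := by
  induction m using Decomposition.inductionOn ℳ with
  | zero => simp
  | homogeneous m => exact D.br_smul ha hb m.2
  | add x y hx hy => simp only [smul_add, map_add, hx, hy]; abel

theorem isDGPoissonIdeal_annihilator (D : DGPoissonModule S ℳ) :
    S.IsDGPoissonIdeal (Module.annihilator A X) := by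
  have hom := isHomogeneous_annihilator 𝒜 ℳ
  refine ⟨⟨S.isTwoSided_of_isHomogeneous hom, hom, fun _ => ?_⟩, fun a ha b => ?_⟩
  · refine map_mem_of_isHomogeneous 𝒜 hom S.d fun i a hai ha => ?_
    rw [Module.mem_annihilator] at ha ⊢
    exact fun m => by simpa [ha] using (D.d_smul_of_mem hai m).symm
  · refine map_mem_of_isHomogeneous 𝒜 hom (S.br.flip b) (fun i a hai ha => ?_) ha
    refine map_mem_of_forall_homogeneous 𝒜 (S.br a) (fun j c hc => ?_) b
    rw [S.br_mem_comm hai hc, Module.mem_annihilator]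
    rw [Module.mem_annihilator] at ha
    exact fun m => by simpa [ha] using (D.br_smul_of_mem hc hai m).symm

theorem isDGPoissonSubmodule_annihilatedBy (D : DGPoissonModule S ℳ) {I : Ideal A}
    [I.IsTwoSided] (hI : S.IsDGPoissonIdeal I) : D.IsDGPoissonSubmodule (annihilatedBy X I) where
  isHomogeneous := isHomogeneous_annihilatedBy ℳ hI.isHomogeneous
  d_mem x hx := mem_annihilatedBy_of_homogeneous hI.isHomogeneous fun i a hai ha => by
    have h := D.d_smul_of_mem hai x
    rw [hx a ha, hx _ (hI.d_mem a ha), map_zero, zero_add] at h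
    exact (smul_eq_zero_iff_eq _).1 h.symm
  br_mem b x hx := by
    refine map_mem_of_forall_homogeneous 𝒜 (D.br.flip x) (fun i b hb => ?_) b
    refine mem_annihilatedBy_of_homogeneous hI.isHomogeneous fun j a haj ha => ?_
    have hba : S.br b a ∈ I := (S.br_mem_comm haj hb).1 (hI.br_mem a ha b)
    have h := D.br_smul_of_mem hb haj x
    rw [hx a ha, hx _ hba, map_zero, zero_add] at h
    exact (smul_eq_zero_iff_eq _).1 h.symm

theorem IsSimple.annihilator_eq {D : DGPoissonModule S ℳ} (hD : D.IsSimple) {M P : Ideal A}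
    (hM : S.IsMaximalDGIdeal M) (hP : IsGreatest {Q : Ideal A | S.IsDGPoissonIdeal Q ∧ Q ≤ M} P)
    {ψ : X} (hψ : ψ ≠ 0) (hMψ : ∀ a ∈ M, a • ψ = 0) : Module.annihilator A X = P := by
  refine le_antisymm (hP.2 ⟨D.isDGPoissonIdeal_annihilator, ?_⟩) ?_
  · have hsup : M ⊔ Module.annihilator A X ≤ (LinearMap.toSpanSingleton A X ψ).ker :=
      sup_le hMψ fun a ha => Module.mem_annihilator.1 ha ψ
    have htop : M ⊔ Module.annihilator A X ≠ ⊤ := fun h => hψ <| by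
      rw [← one_smul A ψ]
      exact hsup (h.ge (Submodule.mem_top (x := 1)))
    rw [hM.eq_of_le ⟨hM.prop.1.sup D.isDGPoissonIdeal_annihilator.toIsDGIdeal, htop⟩ le_sup_left]
    exact le_sup_right
  · have := hP.1.1.isTwoSided
    have hψP : ψ ∈ annihilatedBy X P := fun a ha => hMψ a (hP.1.2 ha)
    have htop := (hD.eq_bot_or_eq_top _ (D.isDGPoissonSubmodule_annihilatedBy hP.1.1)).resolve_left
      (Submodule.ne_bot_iff _ |>.2 ⟨ψ, hψP, hψ⟩)
    exact fun a ha => Module.mem_annihilator.2 fun x => htop.ge (Submodule.mem_top (x := x)) a ha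

end DGPoissonModule

end Annihilator

namespace DGPoissonModule

variable {k A X : Type*} [Field k] [Ring A] [Algebra k A]
  {𝒜 : ℤ → Submodule k A} [GradedAlgebra 𝒜] {S : DGPoisson 𝒜}
  [AddCommGroup X] [Module k X] [Module A X] [IsScalarTower k A X]
  {ℳ : ℤ → Submodule k X} [Decomposition ℳ] [SetLike.GradedSMul 𝒜 ℳ]
  (D : DGPoissonModule S ℳ)

section Submodule

variable {W : Submodule A X}

/-- A DG Poisson submodule, regarded as a DG Poisson module. -/
noncomputable def restrict (hW : D.IsDGPoissonSubmodule W) :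
    letI := homogeneousDecomposition hW.isHomogeneous
    DGPoissonModule S (submoduleGrading ℳ W) :=
  letI := homogeneousDecomposition hW.isHomogeneous
  { d := D.d.restrict (p := W.restrictScalars k) (q := W.restrictScalars k) hW.d_mem
    br := LinearMap.mk₂ k (fun a (m : W) => (⟨D.br a m, hW.br_mem a m m.2⟩ : W))
      (fun a b m => Subtype.ext (D.br.map_add₂ a b (m : X)))
      (fun c a m => Subtype.ext (D.br.map_smul₂ c a (m : X)))
      (fun a m n => Subtype.ext (map_add (D.br a) (m : X) n))
      (fun c a m => Subtype.ext (map_smul (D.br a) c (m : X)))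
    d_mem := D.d_mem
    br_mem := D.br_mem
    d_d m := Subtype.ext (D.d_d m)
    d_smul ha hm := Subtype.ext (D.d_smul ha hm)
    br_smul ha hb hm := Subtype.ext (D.br_smul ha hb hm)
    mul_br ha hb hm := Subtype.ext (D.mul_br ha hb hm)
    br_br ha hb hm := Subtype.ext (D.br_br ha hb hm)
    d_br ha hm := Subtype.ext (D.d_br ha hm) }

theorem isDGPoissonSubmodule_map_subtype (hW : D.IsDGPoissonSubmodule W) {N : Submodule A W}
    (hN : letI := homogeneousDecomposition hW.isHomogeneous
      (D.restrict hW).IsDGPoissonSubmodule N) :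
    D.IsDGPoissonSubmodule (N.map W.subtype) := by
  let _ := homogeneousDecomposition hW.isHomogeneous
  refine ⟨?_, ?_, ?_⟩
  · rintro i _ ⟨x, hx, rfl⟩
    have hcomp := coe_decompose_apply_of_injective (submoduleGrading ℳ W) ℳ Function.injective_id
      W.subtype (fun _ _ h => h) x i
    exact ⟨_, hN.isHomogeneous i hx, hcomp.symm⟩
  · rintro _ ⟨x, hx, rfl⟩
    exact ⟨_, hN.d_mem x hx, rfl⟩
  · rintro a _ ⟨x, hx, rfl⟩
    exact ⟨_, hN.br_mem a x hx, rfl⟩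

end Submodule

section Quotient

variable {L : Submodule A X}

/-- The quotient of a DG Poisson module by a DG Poisson submodule. -/
noncomputable def quotient (hL : D.IsDGPoissonSubmodule L) :
    letI := quotientDecomposition hL.isHomogeneous
    DGPoissonModule S (quotientGrading ℳ L) :=
  letI := quotientDecomposition hL.isHomogeneous
  { d := quotientMap D.d hL.d_mem
    br := quotientMap₂ D.br hL.br_mem
    d_mem := by
      rintro i _ ⟨x, hx, rfl⟩
      exact mkQ_mem_quotientGrading (D.d_mem hx)
    br_mem := by
      rintro i j a _ ha ⟨x, hx, rfl⟩
      exact mkQ_mem_quotientGrading (D.br_mem ha hx)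
    d_d m := by
      obtain ⟨x, rfl⟩ := L.mkQ_surjective m
      exact congrArg L.mkQ (D.d_d x)
    d_smul := by
      rintro i j a _ ha ⟨x, hx, rfl⟩
      exact congrArg L.mkQ (D.d_smul ha hx)
    br_smul := by
      rintro i j l a b _ ha hb ⟨x, hx, rfl⟩
      exact congrArg L.mkQ (D.br_smul ha hb hx)
    mul_br := by
      rintro i j l a b _ ha hb ⟨x, hx, rfl⟩
      exact congrArg L.mkQ (D.mul_br ha hb hx)
    br_br := by
      rintro i j l a b _ ha hb ⟨x, hx, rfl⟩
      exact congrArg L.mkQ (D.br_br ha hb hx)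
    d_br := by
      rintro i j a _ ha ⟨x, hx, rfl⟩
      exact congrArg L.mkQ (D.d_br ha hx) }

theorem isDGPoissonSubmodule_comap_mkQ (hL : D.IsDGPoissonSubmodule L) {N : Submodule A (X ⧸ L)}
    (hN : letI := quotientDecomposition hL.isHomogeneous
      (D.quotient hL).IsDGPoissonSubmodule N) :
    D.IsDGPoissonSubmodule (N.comap L.mkQ) := by
  let _ := quotientDecomposition hL.isHomogeneous
  refine ⟨fun i x hx => ?_, fun x => hN.d_mem (L.mkQ x), fun a x => hN.br_mem a (L.mkQ x)⟩
  have hcomp := coe_decompose_apply_of_injective ℳ (quotientGrading ℳ L) Function.injective_id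
    L.mkQ (fun _ _ => mkQ_mem_quotientGrading) x i
  exact hcomp.subst (motive := (· ∈ N)) (hN.isHomogeneous i hx)

end Quotient

section Lattice

theorem isDGPoissonSubmodule_bot : D.IsDGPoissonSubmodule ⊥ where
  isHomogeneous i x hx := by simp [(Submodule.mem_bot A).1 hx]
  d_mem m hm := by simp [(Submodule.mem_bot A).1 hm]
  br_mem a m hm := by simp [(Submodule.mem_bot A).1 hm]

variable {D} {c : Set (Submodule A X)}

theorem IsDGPoissonSubmodule.sInf (hc : ∀ N ∈ c, D.IsDGPoissonSubmodule N) :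
    D.IsDGPoissonSubmodule (sInf c) where
  isHomogeneous i _ hx := Submodule.mem_sInf.2 fun N hN =>
    (hc N hN).isHomogeneous i (Submodule.mem_sInf.1 hx N hN)
  d_mem x hx := Submodule.mem_sInf.2 fun N hN =>
    (hc N hN).d_mem x (Submodule.mem_sInf.1 hx N hN)
  br_mem a x hx := Submodule.mem_sInf.2 fun N hN =>
    (hc N hN).br_mem a x (Submodule.mem_sInf.1 hx N hN)

theorem IsDGPoissonSubmodule.sSup_of_isChain (hne : c.Nonempty) (hchain : IsChain (· ≤ ·) c)
    (hc : ∀ N ∈ c, D.IsDGPoissonSubmodule N) : D.IsDGPoissonSubmodule (sSup c) := by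
  have hmem (x : X) : x ∈ SupSet.sSup c ↔ ∃ N ∈ c, x ∈ N :=
    Submodule.mem_sSup_of_directed hne hchain.directedOn
  refine ⟨fun i x hx => ?_, fun x hx => ?_, fun a x hx => ?_⟩ <;>
    obtain ⟨N, hN, hx⟩ := (hmem x).1 hx
  · exact (hmem _).2 ⟨N, hN, (hc N hN).isHomogeneous i hx⟩
  · exact (hmem _).2 ⟨N, hN, (hc N hN).d_mem x hx⟩
  · exact (hmem _).2 ⟨N, hN, (hc N hN).br_mem a x hx⟩

end Lattice

/-- The DG Poisson submodule generated by `ψ`. -/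
def span (ψ : X) : Submodule A X := sInf {N | D.IsDGPoissonSubmodule N ∧ ψ ∈ N}

theorem isDGPoissonSubmodule_span (ψ : X) : D.IsDGPoissonSubmodule (D.span ψ) :=
  .sInf fun _ hN => hN.1

theorem mem_span_self (ψ : X) : ψ ∈ D.span ψ :=
  Submodule.mem_sInf.2 fun _ hN => hN.2

theorem eq_top_of_mem_span {ψ : X} {N : Submodule A (D.span ψ)}
    (hN : letI := homogeneousDecomposition (D.isDGPoissonSubmodule_span ψ).isHomogeneous
      (D.restrict (D.isDGPoissonSubmodule_span ψ)).IsDGPoissonSubmodule N)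
    (hψ : ⟨ψ, D.mem_span_self ψ⟩ ∈ N) : N = ⊤ := by
  have hle : D.span ψ ≤ N.map (D.span ψ).subtype :=
    sInf_le ⟨D.isDGPoissonSubmodule_map_subtype _ hN, _, hψ, rfl⟩
  refine eq_top_iff.2 fun x _ => ?_
  obtain ⟨y, hy, hyx⟩ := hle x.2
  rwa [← Subtype.ext hyx]

theorem exists_maximal_notMem {ψ : X} (hψ : ψ ≠ 0) :
    ∃ L : Submodule A X, Maximal (fun N => D.IsDGPoissonSubmodule N ∧ ψ ∉ N) L := by
  obtain ⟨L, -, hL⟩ := zorn_le_nonempty₀ {N : Submodule A X | D.IsDGPoissonSubmodule N ∧ ψ ∉ N}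
    (fun c hc hchain N hN => by
      refine ⟨sSup c, ⟨.sSup_of_isChain ⟨N, hN⟩ hchain fun _ h => (hc h).1, fun h => ?_⟩,
        fun _ => le_sSup⟩
      obtain ⟨N', hN', h⟩ := (Submodule.mem_sSup_of_directed ⟨N, hN⟩ hchain.directedOn).1 h
      exact (hc hN').2 h)
    ⊥ ⟨D.isDGPoissonSubmodule_bot, by simpa using hψ⟩
  exact ⟨L, hL⟩

theorem exists_isSimple_quotient {ψ : X} (hψ : ψ ≠ 0)
    (hgen : ∀ N, D.IsDGPoissonSubmodule N → ψ ∈ N → N = ⊤) :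
    ∃ (L : Submodule A X) (hL : D.IsDGPoissonSubmodule L), ψ ∉ L ∧
      letI := quotientDecomposition hL.isHomogeneous
      (D.quotient hL).IsSimple := by
  obtain ⟨L, hL⟩ := D.exists_maximal_notMem hψ
  let _ := quotientDecomposition hL.prop.1.isHomogeneous
  refine ⟨L, hL.prop.1, hL.prop.2, ?_, fun N hN => ?_⟩
  · exact Submodule.Quotient.nontrivial_iff.2 fun h => hL.prop.2 (h ▸ Submodule.mem_top)
  have hcomap := D.isDGPoissonSubmodule_comap_mkQ hL.prop.1 hN
  by_cases hψN : ψ ∈ N.comap L.mkQ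
  · right
    exact Submodule.comap_injective_of_surjective L.mkQ_surjective (hgen _ hcomap hψN)
  · left
    rw [← Submodule.map_comap_eq_of_surjective L.mkQ_surjective N,
      ← hL.eq_of_le ⟨hcomap, hψN⟩ (L.le_comap_mkQ N), Submodule.mkQ_map_self]

theorem exists_isSimple_annihilator_eq {X : Type w} [AddCommGroup X] [Module k X] [Module A X]
    [IsScalarTower k A X] {ℳ : ℤ → Submodule k X} [Decomposition ℳ] [SetLike.GradedSMul 𝒜 ℳ]
    (D : DGPoissonModule S ℳ) {M P : Ideal A} (hM : S.IsMaximalDGIdeal M)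
    (hP : IsGreatest {Q : Ideal A | S.IsDGPoissonIdeal Q ∧ Q ≤ M} P) {φ : X} (hφ : φ ≠ 0)
    (hMφ : ∀ a ∈ M, a • φ = 0) :
    ∃ (Y : Type w) (_ : AddCommGroup Y) (_ : Module k Y) (_ : Module A Y)
      (_ : IsScalarTower k A Y) (𝒩 : ℤ → Submodule k Y) (_ : Decomposition 𝒩)
      (_ : SetLike.GradedSMul 𝒜 𝒩) (E : DGPoissonModule S 𝒩),
      E.IsSimple ∧ P = Module.annihilator A Y := by
  have hW := D.isDGPoissonSubmodule_span φ
  let _ := homogeneousDecomposition hW.isHomogeneous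
  let ψ : D.span φ := ⟨φ, D.mem_span_self φ⟩
  obtain ⟨L, hL, hψL, hsimple⟩ := (D.restrict hW).exists_isSimple_quotient (ψ := ψ)
    (fun h => hφ (congrArg Subtype.val h)) fun N hN hψN => D.eq_top_of_mem_span hN hψN
  have hψ : L.mkQ ψ ≠ 0 := fun h => hψL ((Submodule.Quotient.mk_eq_zero L).1 h)
  have hMψ : ∀ a ∈ M, a • L.mkQ ψ = 0 := fun a ha =>
    congrArg L.mkQ (show a • ψ = 0 from Subtype.ext (hMφ a ha))
  let _ := quotientDecomposition hL.isHomogeneous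
  exact ⟨_, _, _, _, inferInstance, quotientGrading _ L, inferInstance, inferInstance,
    (D.restrict hW).quotient hL, hsimple, (hsimple.annihilator_eq hM hP hψ hMψ).symm⟩

end DGPoissonModule

section Parity

variable {k X : Type*} [CommRing k] [AddCommGroup X] [Module k X]

/-- The parity involution of a `ℤ`-graded module, which is `(-1) ^ i` in degree `i`. -/
noncomputable def parity (ℳ : ℤ → Submodule k X) [Decomposition ℳ] : X →ₗ[k] X :=
  DirectSum.toModule k ℤ X (fun i => (i.negOnePow : ℤ) • (ℳ i).subtype) ∘ₗ
    (decomposeLinearEquiv ℳ).toLinearMap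

variable {ℳ : ℤ → Submodule k X} [Decomposition ℳ]

theorem parity_of_mem {i : ℤ} {x : X} (hx : x ∈ ℳ i) : parity ℳ x = i.negOnePow • x := by
  rw [parity, LinearMap.comp_apply, LinearEquiv.coe_coe, decomposeLinearEquiv_apply,
    decompose_of_mem ℳ hx, ← DirectSum.lof_eq_of k, toModule_lof, Units.smul_def]
  rfl

theorem parity_mem {i : ℤ} {x : X} (hx : x ∈ ℳ i) : parity ℳ x ∈ ℳ i := by
  rw [parity_of_mem hx, Units.smul_def]
  exact zsmul_mem hx _

end Parity

section GradedDual

variable {ι k X : Type*} [CommRing k] [AddCommGroup X] [Module k X]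

/-- The functionals on `X` of degree `n`, that is, those vanishing on `ℳ i` for `i ≠ -n`. -/
def dualPiece [Neg ι] (ℳ : ι → Submodule k X) (n : ι) : Submodule k (Module.Dual k X) :=
  ⨅ i, ⨅ _ : i ≠ -n, (ℳ i).dualAnnihilator

theorem mem_dualPiece [Neg ι] {ℳ : ι → Submodule k X} {n : ι} {φ : Module.Dual k X} :
    φ ∈ dualPiece ℳ n ↔ ∀ i ≠ -n, ∀ x ∈ ℳ i, φ x = 0 := by
  simp only [dualPiece, Submodule.mem_iInf, Submodule.mem_dualAnnihilator]

theorem iSupIndep_dualPiece [DecidableEq ι] [InvolutiveNeg ι] (ℳ : ι → Submodule k X)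
    [Decomposition ℳ] : iSupIndep (dualPiece ℳ) := by
  refine fun n => Submodule.disjoint_def.2 fun φ hφ hφ' => ?_
  have hle : ⨆ m, ⨆ _ : m ≠ n, dualPiece ℳ m ≤ (ℳ (-n)).dualAnnihilator :=
    iSup₂_le fun m hm ψ hψ => (Submodule.mem_dualAnnihilator ψ).2
      (mem_dualPiece.1 hψ (-n) (neg_injective.ne hm.symm))
  refine linearMap_ext_of_homogeneous ℳ fun i x hx => ?_
  obtain rfl | hi := eq_or_ne i (-n)
  · exact (Submodule.mem_dualAnnihilator φ).1 (hle hφ') x hx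
  · exact mem_dualPiece.1 hφ i hi x hx

variable [AddGroup ι]

theorem comp_mem_dualPiece {ℳ : ι → Submodule k X} {c n : ι} {f : X →ₗ[k] X}
    (hf : ∀ i, ∀ x ∈ ℳ i, f x ∈ ℳ (i + c)) {φ : Module.Dual k X} (hφ : φ ∈ dualPiece ℳ n) :
    φ ∘ₗ f ∈ dualPiece ℳ (c + n) :=
  mem_dualPiece.2 fun i hi x hx => mem_dualPiece.1 hφ (i + c)
    (fun h => hi (by rw [neg_add_rev, ← h, add_neg_cancel_right])) _ (hf i x hx)

theorem comp_mem_iSup_dualPiece {ℳ : ι → Submodule k X} {c : ι} {f : X →ₗ[k] X}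
    (hf : ∀ i, ∀ x ∈ ℳ i, f x ∈ ℳ (i + c)) {φ : Module.Dual k X}
    (hφ : φ ∈ ⨆ n, dualPiece ℳ n) : φ ∘ₗ f ∈ ⨆ n, dualPiece ℳ n := by
  have hle : ⨆ n, dualPiece ℳ n ≤ (⨆ n, dualPiece ℳ n).comap (LinearMap.lcomp k k f) :=
    iSup_le fun n _ hφ => Submodule.mem_iSup_of_mem (c + n) (comp_mem_dualPiece hf hφ)
  exact hle hφ

variable [DecidableEq ι]

theorem comp_apply_mem_iSup_dualPiece {B : Type*} [AddCommGroup B] [Module k B]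
    {ℳ : ι → Submodule k X} {ℬ : ι → Submodule k B} [Decomposition ℬ] {f : X →ₗ[k] B →ₗ[k] X}
    (hf : ∀ {i j : ι} {x : X} {b : B}, x ∈ ℳ i → b ∈ ℬ j → f x b ∈ ℳ (i + j)) (b : B)
    {φ : Module.Dual k X} (hφ : φ ∈ ⨆ n, dualPiece ℳ n) :
    φ ∘ₗ f.flip b ∈ ⨆ n, dualPiece ℳ n :=
  map_mem_of_forall_homogeneous ℬ (f.flip.compr₂ φ)
    (fun _ b hb => comp_mem_iSup_dualPiece (f := f.flip b) (fun _ _ hx => hf hx hb) hφ) b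

variable {A : Type*} [Ring A] [Algebra k A]

/-- The left action `(b • φ) a = φ (a * b)` of `A` on its dual. It is not a global instance because
for `A = k` it would compete with the pointwise action. -/
@[reducible]
noncomputable def dualAction (k A : Type*) [CommRing k] [Ring A] [Algebra k A] :
    Module A (Module.Dual k A) where
  smul b φ := φ ∘ₗ (LinearMap.mul k A).flip b
  one_smul φ := LinearMap.ext fun a => congrArg φ (mul_one a)
  mul_smul b c φ := LinearMap.ext fun a => congrArg φ (mul_assoc a b c).symm
  smul_zero _ := rfl
  smul_add _ _ _ := rfl
  add_smul b c φ := LinearMap.ext fun a => (congrArg φ (mul_add a b c)).trans (map_add _ _ _)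
  zero_smul φ := LinearMap.ext fun a => (congrArg φ (mul_zero a)).trans (map_zero _)

attribute [local instance] dualAction

theorem dual_smul_apply (b : A) (φ : Module.Dual k A) (a : A) : (b • φ) a = φ (a * b) := rfl

theorem isScalarTower_dual : IsScalarTower k A (Module.Dual k A) where
  smul_assoc c b φ := LinearMap.ext fun a => by simp [dual_smul_apply]

attribute [local instance] isScalarTower_dual

variable (𝒜 : ι → Submodule k A) [GradedAlgebra 𝒜]

theorem gradedSMul_dualPiece : SetLike.GradedSMul 𝒜 (dualPiece 𝒜) where
  smul_mem {_ _ b _} hb := comp_mem_dualPiece (f := (LinearMap.mul k A).flip b)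
    fun _ _ ha => SetLike.mul_mem_graded ha hb

attribute [local instance] gradedSMul_dualPiece

/-- The graded dual of `A`: the sums of homogeneous functionals. -/
noncomputable def gradedDual : Submodule A (Module.Dual k A) where
  __ := ⨆ n, dualPiece 𝒜 n
  smul_mem' b _ hφ :=
    comp_apply_mem_iSup_dualPiece (f := LinearMap.mul k A)
      (fun ha hb => SetLike.mul_mem_graded ha hb) b hφ

noncomputable instance : Decomposition (submoduleGrading (dualPiece 𝒜) (gradedDual 𝒜)) :=
  submoduleDecomposition (iSupIndep_dualPiece 𝒜)
    (iSup_mono fun n => le_inf (le_iSup (dualPiece 𝒜) n) le_rfl)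

theorem exists_gradedDual_ne_zero_of_ne_top {K B : Type*} [Field K] [Ring B] [Algebra K B]
    (ℬ : ι → Submodule K B) [GradedAlgebra ℬ] {M : Ideal B} (hM : M.IsHomogeneous ℬ)
    (hM1 : M ≠ ⊤) : ∃ φ : gradedDual ℬ, φ ≠ 0 ∧ ∀ b ∈ M, b • φ = 0 := by
  obtain ⟨f, hf1, hfM⟩ := Submodule.exists_le_ker_of_notMem (p := M.restrictScalars K)
    (v := (1 : B)) fun h => hM1 ((Ideal.eq_top_iff_one M).2 h)
  have hφ : f ∘ₗ componentMap ℬ 0 ∈ dualPiece ℬ 0 := mem_dualPiece.2 fun i hi b hb => by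
    rw [LinearMap.comp_apply, componentMap_of_mem_ne hb (by simpa using hi), map_zero]
  refine ⟨⟨_, Submodule.mem_iSup_of_mem 0 hφ⟩, fun h => hf1 ?_, fun b hb => ?_⟩
  · have h1 : f (componentMap ℬ 0 1) = 0 := LinearMap.congr_fun (congrArg Subtype.val h) 1
    rwa [componentMap_of_mem_same SetLike.GradedOne.one_mem] at h1
  · exact Subtype.ext (LinearMap.ext fun a => hfM (hM 0 (M.mul_mem_left a hb)))

end GradedDual

namespace DGPoisson

variable {k A : Type*} [Field k] [Ring A] [Algebra k A] {𝒜 : ℤ → Submodule k A}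
  [GradedAlgebra 𝒜] (S : DGPoisson 𝒜)

section Identities

theorem mul_br {i j l : ℤ} {a b c : A} (ha : a ∈ 𝒜 i) (hb : b ∈ 𝒜 j) (hc : c ∈ 𝒜 l) :
    S.br (a * b) c = a * S.br b c + (j * l).negOnePow • (S.br a c * b) := by
  rw [S.antisymm (SetLike.mul_mem_graded ha hb) hc, S.br_mul hc ha hb, S.antisymm hc ha,
    S.antisymm hc hb, add_mul, Int.negOnePow_add, mul_comm l i, mul_comm l j]
  rcases Int.units_eq_one_or (i * l).negOnePow with h | h <;>
  rcases Int.units_eq_one_or (j * l).negOnePow with h' | h' <;>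
  simp [h, h']

theorem jacobi_right {i j l : ℤ} {a b c : A} (ha : a ∈ 𝒜 i) (hb : b ∈ 𝒜 j) (hc : c ∈ 𝒜 l) :
    S.br (S.br a b) c = S.br a (S.br b c) + (j * l).negOnePow • S.br (S.br a c) b := by
  rw [S.jacobi ha hb hc, S.antisymm hb (S.br_mem ha hc), mul_add, Int.negOnePow_add,
    mul_comm j i]
  rcases Int.units_eq_one_or (i * j).negOnePow with h | h <;>
  rcases Int.units_eq_one_or (j * l).negOnePow with h' | h' <;>
  simp [h, h']

theorem br_mul_eq_mul_br_add {i j l : ℤ} {a b c : A} (ha : a ∈ 𝒜 i) (hb : b ∈ 𝒜 j) (hc : c ∈ 𝒜 l) :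
    S.br a b * c = a * S.br b c + (j * l).negOnePow • S.br (a * c) b := by
  rw [S.mul_br ha hc hb, S.antisymm hb hc, mul_comm l j]
  rcases Int.units_eq_one_or (j * l).negOnePow with h | h <;> simp [h]

theorem br_mul_eq_br_mul_add {i j l : ℤ} {a b c : A} (ha : a ∈ 𝒜 i) (hb : b ∈ 𝒜 j) (hc : c ∈ 𝒜 l) :
    S.br a (b * c) = S.br (a * b) c + (j * l).negOnePow • S.br (a * c) b := by
  rw [S.br_mul ha hb hc, S.mul_br ha hb hc, S.mul_br ha hc hb, S.comm hb (S.br_mem ha hc),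
    S.antisymm hb hc, mul_add, Int.negOnePow_add, mul_comm j i, mul_comm l j]
  rcases Int.units_eq_one_or (i * j).negOnePow with h | h <;>
  rcases Int.units_eq_one_or (j * l).negOnePow with h' | h' <;>
  simp [h, h'] <;> abel

end Identities

section DualModule

attribute [local instance] dualAction isScalarTower_dual gradedSMul_dualPiece

theorem parity_d_mem {i : ℤ} {a : A} (ha : a ∈ 𝒜 i) : (parity 𝒜 ∘ₗ S.d) a ∈ 𝒜 (i + 1) :=
  parity_mem (S.d_mem ha)

/-- The differential `(dφ) a = -(-1) ^ |a| * φ (d a)` on the dual of `A`, the sign being the parity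
of `d a`. -/
noncomputable def dualD : Module.Dual k A →ₗ[k] Module.Dual k A :=
  LinearMap.lcomp k k (parity 𝒜 ∘ₗ S.d)

theorem dualD_apply (φ : Module.Dual k A) {i : ℤ} {a : A} (ha : a ∈ 𝒜 i) :
    S.dualD φ a = -(i.negOnePow • φ (S.d a)) := by
  rw [dualD, LinearMap.lcomp_apply, LinearMap.comp_apply, parity_of_mem (S.d_mem ha),
    Int.negOnePow_succ, Units.neg_smul, map_neg, map_zsmul_unit]

/-- The bracket `{b, φ} a = φ {a, b}` on the dual of `A`. -/
noncomputable def dualBr : A →ₗ[k] Module.Dual k A →ₗ[k] Module.Dual k A :=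
  (LinearMap.llcomp k A A k).flip ∘ₗ S.br.flip

theorem dualBr_apply (b : A) (φ : Module.Dual k A) (a : A) : S.dualBr b φ a = φ (S.br a b) := rfl

theorem dualD_dualD (φ : Module.Dual k A) : S.dualD (S.dualD φ) = 0 :=
  linearMap_ext_of_homogeneous 𝒜 fun i a ha => by
    simp [S.dualD_apply _ ha, S.dualD_apply _ (S.d_mem ha), S.d_d]

theorem dualD_smul {j : ℤ} {b : A} (hb : b ∈ 𝒜 j) (φ : Module.Dual k A) :
    S.dualD (b • φ) = S.d b • φ + j.negOnePow • (b • S.dualD φ) :=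
  linearMap_ext_of_homogeneous 𝒜 fun i a ha => by
    rw [S.dualD_apply _ ha, LinearMap.add_apply, LinearMap.smul_apply,
      dual_smul_apply, dual_smul_apply, dual_smul_apply,
      S.dualD_apply _ (SetLike.mul_mem_graded ha hb), S.d_mul ha hb, map_add,
      Int.negOnePow_add]
    rcases Int.units_eq_one_or i.negOnePow with h | h <;>
    rcases Int.units_eq_one_or j.negOnePow with h' | h' <;>
    simp [h, h']

theorem dualD_dualBr {j : ℤ} {b : A} (hb : b ∈ 𝒜 j) (φ : Module.Dual k A) :
    S.dualD (S.dualBr b φ) = S.dualBr (S.d b) φ + j.negOnePow • S.dualBr b (S.dualD φ) :=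
  linearMap_ext_of_homogeneous 𝒜 fun i a ha => by
    rw [S.dualD_apply _ ha, LinearMap.add_apply, LinearMap.smul_apply,
      dualBr_apply, dualBr_apply, dualBr_apply,
      S.dualD_apply _ (S.br_mem ha hb), S.d_br ha hb, map_add,
      Int.negOnePow_add]
    rcases Int.units_eq_one_or i.negOnePow with h | h <;>
    rcases Int.units_eq_one_or j.negOnePow with h' | h' <;>
    simp [h, h']

theorem dualBr_smul {j l : ℤ} {b c : A} (hb : b ∈ 𝒜 j) (hc : c ∈ 𝒜 l) (φ : Module.Dual k A) :
    S.dualBr b (c • φ) = S.br b c • φ + (j * l).negOnePow • (c • S.dualBr b φ) :=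
  linearMap_ext_of_homogeneous 𝒜 fun i a ha => by
    simp only [LinearMap.add_apply, LinearMap.smul_apply, dualBr_apply, dual_smul_apply,
      S.br_mul_eq_mul_br_add ha hb hc, map_add, map_zsmul_unit]

theorem dualBr_mul {j l : ℤ} {b c : A} (hb : b ∈ 𝒜 j) (hc : c ∈ 𝒜 l) (φ : Module.Dual k A) :
    S.dualBr (b * c) φ = b • S.dualBr c φ + (j * l).negOnePow • (c • S.dualBr b φ) :=
  linearMap_ext_of_homogeneous 𝒜 fun i a ha => by
    simp only [LinearMap.add_apply, LinearMap.smul_apply, dualBr_apply, dual_smul_apply,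
      S.br_mul_eq_br_mul_add ha hb hc, map_add, map_zsmul_unit]

theorem dualBr_dualBr {j l : ℤ} {b c : A} (hb : b ∈ 𝒜 j) (hc : c ∈ 𝒜 l)
    (φ : Module.Dual k A) :
    S.dualBr b (S.dualBr c φ) =
      S.dualBr (S.br b c) φ + (j * l).negOnePow • S.dualBr c (S.dualBr b φ) :=
  linearMap_ext_of_homogeneous 𝒜 fun i a ha => by
    simp only [LinearMap.add_apply, LinearMap.smul_apply, dualBr_apply,
      S.jacobi_right ha hb hc, map_add, map_zsmul_unit]

/-- The graded dual of a DG Poisson algebra as a DG Poisson module. -/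
noncomputable def dualModule :
    DGPoissonModule (X := gradedDual 𝒜) S (submoduleGrading (dualPiece 𝒜) (gradedDual 𝒜)) where
  d := S.dualD.restrict (p := (gradedDual 𝒜).restrictScalars k)
    (q := (gradedDual 𝒜).restrictScalars k) fun _ =>
      comp_mem_iSup_dualPiece fun _ _ => S.parity_d_mem
  br := LinearMap.mk₂ k (fun b φ => ⟨S.dualBr b φ,
      comp_apply_mem_iSup_dualPiece (fun ha hb => S.br_mem ha hb) b φ.2⟩)
    (fun _ _ _ => Subtype.ext (LinearMap.map_add₂ _ _ _ _))
    (fun _ _ _ => Subtype.ext (LinearMap.map_smul₂ _ _ _ _))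
    (fun _ _ _ => Subtype.ext (map_add _ _ _))
    (fun _ _ _ => Subtype.ext (map_smul _ _ _))
  d_mem {n φ} hφ := by
    rw [add_comm n 1]
    exact comp_mem_dualPiece (fun _ _ => S.parity_d_mem) hφ
  br_mem {_ _ b _} hb hφ := comp_mem_dualPiece (f := S.br.flip b) (fun _ _ ha => S.br_mem ha hb) hφ
  d_d φ := Subtype.ext (S.dualD_dualD φ)
  d_smul hb _ := Subtype.ext (S.dualD_smul hb _)
  br_smul hb hc _ := Subtype.ext (S.dualBr_smul hb hc _)
  mul_br hb hc _ := Subtype.ext (S.dualBr_mul hb hc _)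
  br_br hb hc _ := Subtype.ext (S.dualBr_dualBr hb hc _)
  d_br hb _ := Subtype.ext (S.dualD_dualBr hb _)

end DualModule

end DGPoisson

attribute [local instance] dualAction isScalarTower_dual gradedSMul_dualPiece in
theorem mainTheorem4_general {k : Type u} [Field k] {A : Type w} [Ring A] [Algebra k A]
    (𝒜 : ℤ → Submodule k A) [GradedAlgebra 𝒜] (SA : DGPoisson 𝒜) (P : Ideal A)
    (hP : SA.IsSymplectic P) :
    ∃ (X : Type (max u w)) (_ : AddCommGroup X) (_ : Module k X) (_ : Module A X)
      (_ : IsScalarTower k A X) (ℳ : ℤ → Submodule k X) (_ : DirectSum.Decomposition ℳ)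
      (_ : SetLike.GradedSMul 𝒜 ℳ) (D : DGPoissonModule SA ℳ),
      D.IsSimple ∧ P = Module.annihilator A X := by
  obtain ⟨M, hM, hPM⟩ := hP
  obtain ⟨φ, hφ, hMφ⟩ := exists_gradedDual_ne_zero_of_ne_top 𝒜 hM.prop.1.isHomogeneous hM.prop.2
  exact SA.dualModule.exists_isSimple_annihilator_eq hM hPM hφ hMφ

theorem mainTheorem4 {k : Type u} [Field k]
    -- the polynomial DG Poisson algebra `R`
    {Λ : Type v} (deg : Λ → ℤ) (SR : DGPoisson (GradedPoly.grading k deg))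
    -- the DG Poisson algebra `A`
    {A : Type w} [Ring A] [Algebra k A] (𝒜 : ℤ → Submodule k A) [GradedAlgebra 𝒜]
    (SA : DGPoisson 𝒜)
    -- `A` is a DG Poisson homomorphic image of `R`
    (π : GradedPoly k deg →ₐ[k] A) (hπ : SR.IsHom SA π) (hsurj : Function.Surjective π)
    (P : Ideal A) (hP : SA.IsSymplectic P) :
    ∃ (X : Type (max u w)) (_ : AddCommGroup X) (_ : Module k X) (_ : Module A X)
      (_ : IsScalarTower k A X) (ℳ : ℤ → Submodule k X) (_ : DirectSum.Decomposition ℳ)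
      (_ : SetLike.GradedSMul 𝒜 ℳ) (D : DGPoissonModule SA ℳ),
      D.IsSimple ∧ P = Module.annihilator A X :=
  mainTheorem4_general 𝒜 SA P hP
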